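/- Let $F$ be a field with $\operatorname{char} F\neq 2$ and let $n\ge 1$. Say that $(i,j)$ dominates $(i',j')$ if $i\ge i'$ and $j\le j'$. A ladder of size $n$ is a (possibly empty) set $L=\{(i_1,j_1),\dots,(i_s,j_s)\}\subseteq\{1,\dots,n\}^2$ with $i_1<\dots<i_s$ and $j_1<\dots<j_s$; $M_L$ is the space of all $n\times n$ matrices over $F$ whose entries vanish at every position not dominated by some $(i_\ell,j_\ell)$. The ladder is dominant upper triangular (DUT) if $j_\ell\le i_\ell$ for $1\le \ell\le s$ and $i_\ell<j_{\ell+1}$ for $1\le \ell\le s-1$; then $M_L$ is a Lie algebra under $[X,Y]=XY-YX$. Let $\gamma_L=\left(\{i_1,\dots,i_s\}\cup\{j_1-1,\dots,j_s-1\}\right)\setminus\{0,n\}$ and $t=|\gamma_L|+1$. Cutting the rows and the columns right after the positions in $\gamma_L$ turns every $n\times n$ matrix into a $t\times t$ block matrix; let $\widetilde{\mathcal M}_{pq}$ be the space of the $n\times n$ matrices that vanish outside the $(p,q)$ block, and let $[I(L)]$ be the set of those $(p,q)\in\{1,\dots,t\}^2$ for which some matrix of $M_L$ has a nonzero $(p,q)$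 block. Suppose that $L$ is DUT and that at least one diagonal block of $M_L$ is zero, i.e. $(k,k)\notin[I(L)]$ for some $k\in\{1,\dots,t\}$. Then every derivation $f$ of the Lie algebra $M_L$ (an $F$-linear map $f:M_L\to M_L$ with $f([X,Y])=[f(X),Y]+[X,f(Y)]$) satisfies, for every $(i,j)\in[I(L)]$, $$f\bigl(\widetilde{\mathcal M}_{ij}\bigr)\subseteq \sum_{\substack{(p,q)\in[I(L)]\\ (i,j)\text{ dominates }(p,q)}}\widetilde{\mathcal M}_{pq}.$$ -/

import Mathlib

attribute [local instance] LieRing.ofAssociativeRing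

/-- `(i₁, j₁)` dominates `(i₂, j₂)` when `i₂ ≤ i₁` and `j₁ ≤ j₂`. -/
def Dominates {α : Type*} [LE α] (x y : α × α) : Prop :=
  y.1 ≤ x.1 ∧ x.2 ≤ y.2

/-- A ladder of size `n`: finitely many corner points `(row ℓ, col ℓ)` with strictly increasing
row indices and strictly increasing column indices. Matrix indices are `0, …, n - 1`
(the usual index minus one). The empty ladder (`step = 0`) is allowed. -/
structure Ladder (n : ℕ) where
  /-- the number of corner points -/
  step : ℕ
  /-- row indices of the corner points -/
  row : Fin step → Fin n
  /-- column indices of the corner points -/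
  col : Fin step → Fin n
  row_strictMono : StrictMono row
  col_strictMono : StrictMono col

namespace Ladder

variable {n : ℕ}

/-- The index set `I(L)`: the positions dominated by some corner point. -/
def indexSet (L : Ladder n) : Set (Fin n × Fin n) :=
  {x | ∃ l : Fin L.step, Dominates (L.row l, L.col l) x}

/-- The space `M_L` of `L`-ladder matrices: the matrices with zero entries outside `I(L)`. -/
def matrices (L : Ladder n) (F : Type*) [Field F] : Submodule F (Matrix (Fin n) (Fin n) F) where
  carrier := {A | ∀ a b, (a, b) ∉ L.indexSet → A a b = 0}
  zero_mem' := by intro a b _; rfl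
  add_mem' := by
    intro A B hA hB a b hab
    simp [hA a b hab, hB a b hab]
  smul_mem' := by
    intro c A hA a b hab
    simp [hA a b hab]

/-- Upper triangular ladder: `i_ℓ < j_{ℓ+1}` for consecutive corner points. -/
def IsUpperTriangular (L : Ladder n) : Prop :=
  ∀ l m : Fin L.step, (l : ℕ) + 1 = m → L.row l < L.col m

/-- Dominant upper triangular (DUT) ladder: `j_ℓ ≤ i_ℓ` for every corner point and
`i_ℓ < j_{ℓ+1}` for consecutive corner points. -/
structure IsDUT (L : Ladder n) : Prop where
  col_le_row : ∀ l : Fin L.step, L.col l ≤ L.row l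
  isUpperTriangular : L.IsUpperTriangular

/-- For an upper triangular ladder, `M_L` is closed under matrix multiplication. -/
theorem mul_mem_matrices (L : Ladder n) (hL : L.IsUpperTriangular) (F : Type*) [Field F]
    {A B : Matrix (Fin n) (Fin n) F} (hA : A ∈ L.matrices F) (hB : B ∈ L.matrices F) :
    A * B ∈ L.matrices F := by
  intro a b hab
  rw [Matrix.mul_apply]
  refine Finset.sum_eq_zero fun c _ => ?_
  by_cases hac : (a, c) ∈ L.indexSet
  · by_cases hcb : (c, b) ∈ L.indexSet
    · exfalso
      obtain ⟨l, hl1, hl2⟩ := hac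
      obtain ⟨m, hm1, hm2⟩ := hcb
      simp only at hl1 hl2 hm1 hm2
      rcases le_or_gt l m with h | h
      · exact hab ⟨l, hl1, (L.col_strictMono.monotone h).trans hm2⟩
      · have hlt : (m : ℕ) + 1 < L.step := lt_of_le_of_lt (Nat.succ_le_of_lt h) l.2
        have h1 := hL m ⟨(m : ℕ) + 1, hlt⟩ rfl
        have h2 : L.col ⟨(m : ℕ) + 1, hlt⟩ ≤ L.col l :=
          L.col_strictMono.monotone (Fin.le_def.2 (Nat.succ_le_of_lt h))
        exact absurd (lt_of_lt_of_le h1 (h2.trans (hl2.trans hm1))) (lt_irrefl _)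
    · rw [hB c b hcb, mul_zero]
  · rw [hA a c hac, zero_mul]

/-- The Lie algebra `M_L` of an upper triangular ladder, with bracket `[X, Y] = X Y - Y X`. -/
def lieAlgebra (L : Ladder n) (hL : L.IsUpperTriangular) (F : Type*) [Field F] :
    LieSubalgebra F (Matrix (Fin n) (Fin n) F) where
  toSubmodule := L.matrices F
  lie_mem' := by
    intro A B hA hB
    rw [Ring.lie_def]
    exact (L.matrices F).sub_mem (L.mul_mem_matrices hL F hA hB) (L.mul_mem_matrices hL F hB hA)

/-- The partition `γ_L` of the indices. A number `c` in it means a cut right after the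
first `c` rows and columns: one cuts right below every corner row and right before every
corner column (the trivial cuts `0` and `n` are discarded). -/
def partition (L : Ladder n) : Finset ℕ :=
  (Finset.univ.image (fun l : Fin L.step => (L.row l : ℕ) + 1) ∪
    Finset.univ.image (fun l : Fin L.step => (L.col l : ℕ))) \ {0, n}

/-- The number `t = |γ_L| + 1` of parts of the partition. -/
def numParts (L : Ladder n) : ℕ := L.partition.card + 1

/-- The part (numbered `0, …, t - 1` from left to right) of the partition that contains
the index `a`: the number of cuts at or before `a`. -/
def part (L : Ladder n) (a : Fin n) : Fin L.numParts :=
  ⟨(L.partition.filter (fun c => c ≤ (a : ℕ))).card,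
    Nat.lt_succ_of_le (Finset.card_filter_le _ _)⟩

/-- The space of all `n × n` matrices that vanish outside the `(p, q)` block. -/
def block (L : Ladder n) (F : Type*) [Field F] (p q : Fin L.numParts) :
    Submodule F (Matrix (Fin n) (Fin n) F) where
  carrier := {A | ∀ a b, ¬ (L.part a = p ∧ L.part b = q) → A a b = 0}
  zero_mem' := by intro a b _; rfl
  add_mem' := by
    intro A B hA hB a b hab
    simp [hA a b hab, hB a b hab]
  smul_mem' := by
    intro c A hA a b hab
    simp [hA a b hab]

/-- The index set `[I(L)]` of the nonzero blocks of `M_L`: the `(p, q)` such that some matrix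
of `M_L` has a nonzero entry in its `(p, q)` block. -/
def blockIndexSet (L : Ladder n) (F : Type*) [Field F] : Set (Fin L.numParts × Fin L.numParts) :=
  {x | ∃ A ∈ L.matrices F, ∃ a b, L.part a = x.1 ∧ L.part b = x.2 ∧ A a b ≠ 0}

end Ladder

/-! Write `D a b x y` for the (x, y) entry of f(E_ab). The claim becomes: a nonzero `D a b x y`
forces x to lie in a part no later than that of a, and y in a part no earlier than that of b. Only
Leibniz identities between matrix units are needed.

For E_ss in M_L, brackets with suitable units kill the offending entries (`IsDerivationTable.diag`).
The zero diagonal block is essential here: without one, X ↦ tr(X)·1 is a derivation. If a ≠ b and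
E_aa or E_bb is in M_L, then E_ab is an eigenvector of its adjoint action, so 2 ≠ 0 leaves few bad
entries, and further brackets remove them (`left_diag`, `right_diag`). Otherwise E_ab = [E_as, E_sb]
with E_ss in M_L, which reduces to those two cases. -/

/-- The structure constants of a linear map on the span of the matrix units `E a b`, `I a b`:
`D a b x y` is the `(x, y)` entry of the image of `E a b`. The image is supported on `I`, and
the Leibniz rule holds on matrix units. -/
structure IsDerivationTable {F ι : Type*} [Field F] [DecidableEq ι] (I : ι → ι → Prop)
    (D : ι → ι → ι → ι → F) : Prop where
  support : ∀ a b, I a b → ∀ x y, ¬ I x y → D a b x y = 0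
  leibniz : ∀ a b c d, I a b → I c d → ∀ x y,
    (if b = c then D a d x y else 0) - (if d = a then D c b x y else 0) =
      ((if d = y then D a b x c else 0) - (if x = c then D a b d y else 0)) +
      ((if x = a then D c d b y else 0) - (if b = y then D c d x a else 0))

/-- A relation on indices that is block upper triangular for the parts given by `P`, where no
two distinct parts of zero diagonal block are adjacent. -/
structure IsBlockPattern {ι : Type*} (I : ι → ι → Prop) (P : ι → ℕ) : Prop where
  exists_diag : ∀ a b, I a b → ∃ s, I s s ∧ P a ≤ P s ∧ P s ≤ P b
  of_diag : ∀ a b s, I s s → P a ≤ P s → P s ≤ P b → I a b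
  of_lt : ∀ a b, P a < P b → I a b

/-! ### Derivation tables over a block pattern -/

section Table

variable {F ι : Type*} [Field F] {I : ι → ι → Prop} {P : ι → ℕ}

theorem IsBlockPattern.le (hI : IsBlockPattern I P) {a b : ι} (h : I a b) : P a ≤ P b := by
  obtain ⟨s, _, h1, h2⟩ := hI.exists_diag a b h
  exact h1.trans h2

theorem IsBlockPattern.diag_of_eq (hI : IsBlockPattern I P) {a s : ι} (hs : I s s)
    (h : P a = P s) : I a a :=
  hI.of_diag a a s hs h.le h.ge

variable [DecidableEq ι] {D : ι → ι → ι → ι → F}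

theorem IsDerivationTable.le_of_ne_zero (hD : IsDerivationTable I D) (hI : IsBlockPattern I P)
    {a b x y : ι} (hab : I a b) (h : D a b x y ≠ 0) : P x ≤ P y :=
  hI.le (by by_contra hn; exact h (hD.support a b hab x y hn))

theorem IsDerivationTable.diag (hD : IsDerivationTable I D) (hI : IsBlockPattern I P)
    (hgap : ∃ g, ¬ I g g) {s x y : ι} (hs : I s s) (h : D s s x y ≠ 0) :
    P x ≤ P s ∧ P s ≤ P y := by
  have hxy : I x y := by by_contra hn; exact h (hD.support s s hs x y hn)
  have hle := hI.le hxy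
  by_cases hxs : x = s
  · subst hxs; exact ⟨le_rfl, hle⟩
  by_cases hys : y = s
  · subst hys; exact ⟨hle, le_rfl⟩
  by_cases hne : x = y
  · subst hne
    exfalso
    -- E_xg (or E_gx) commutes with E_ss, which forces the diagonal entries of f(E_ss) at x and g to
    -- agree; the one at g is off the support.
    obtain ⟨g, hg⟩ := hgap
    have hsg : s ≠ g := by rintro rfl; exact hg hs
    have hxg : x ≠ g := by rintro rfl; exact hg hxy
    have h0 := hD.support s s hs g g hg
    rcases lt_trichotomy (P x) (P g) with hlt | heq | hlt
    · have := hD.leibniz s s x g hs (hI.of_lt _ _ hlt) x g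
      grind
    · exact hg (hI.diag_of_eq hxy heq.symm)
    · have := hD.leibniz s s g x hs (hI.of_lt _ _ hlt) g x
      grind
  -- E_xx commutes with E_ss, and bracketing f(E_ss) with E_xx isolates its (x, y) entry.
  by_cases hx : I x x
  · have := hD.leibniz x x s s hx hs x y
    grind
  by_cases hy : I y y
  · have := hD.leibniz y y s s hy hs x y
    grind
  constructor
  · by_contra! hlt
    -- In E_sx = [E_ss, E_sx], the (s, y) entry of f(E_sx) cancels from both sides, leaving `D s s x
    -- y = 0`.
    have := hD.leibniz s s s x hs (hI.of_lt _ _ hlt) s y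
    grind
  · by_contra! hlt
    have := hD.leibniz s s y s hs (hI.of_lt _ _ hlt) x s
    grind

/-- Apply f to E_ab = [E_aa, E_ab]. By block triangularity, f(E_aa) contributes only to dominated
entries, so elsewhere D = (δ_xa − δ_ya) D. The factor −1 would give 2D = 0, so it must be 1. -/
theorem IsDerivationTable.eq_of_left_diag (h2 : (2 : F) ≠ 0) (hD : IsDerivationTable I D)
    (hI : IsBlockPattern I P) {a b x y : ι} (ha : I a a) (hne : a ≠ b)
    (hab : I a b) (h : D a b x y ≠ 0) (hdom : ¬ (P x ≤ P a ∧ P b ≤ P y)) : x = a ∧ y ≠ a := by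
  have key := hD.leibniz a a a b ha hab x y
  have l1 := hD.le_of_ne_zero hI (x := x) (y := a) ha
  have l2 := hD.le_of_ne_zero hI (x := b) (y := y) ha
  have l3 : D a b x y * 2 ≠ 0 := mul_ne_zero h h2
  by_cases hx : x = a <;> by_cases hy : y = a <;> by_cases hby : b = y <;> grind

theorem IsDerivationTable.eq_of_right_diag (h2 : (2 : F) ≠ 0) (hD : IsDerivationTable I D)
    (hI : IsBlockPattern I P) {a b x y : ι} (hb : I b b) (hne : a ≠ b)
    (hab : I a b) (h : D a b x y ≠ 0) (hdom : ¬ (P x ≤ P a ∧ P b ≤ P y)) : y = b ∧ x ≠ b := by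
  have key := hD.leibniz a b b b hab hb x y
  have l1 := hD.le_of_ne_zero hI (x := x) (y := a) hb
  have l2 := hD.le_of_ne_zero hI (x := b) (y := y) hb
  have l3 : D a b x y * 2 ≠ 0 := mul_ne_zero h h2
  by_cases hx : x = b <;> by_cases hy : y = b <;> by_cases hby : a = x <;> grind

theorem IsDerivationTable.left_diag (h2 : (2 : F) ≠ 0) (hD : IsDerivationTable I D)
    (hI : IsBlockPattern I P) (hgap : ∃ g, ¬ I g g) {a b x y : ι} (ha : I a a)
    (hab : I a b) (h : D a b x y ≠ 0) : P x ≤ P a ∧ P b ≤ P y := by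
  by_cases hne : a = b
  · subst hne; exact hD.diag hI hgap ha h
  by_contra hdom
  obtain ⟨rfl, hya⟩ := hD.eq_of_left_diag h2 hI ha hne hab h hdom
  have hxy := hD.le_of_ne_zero hI hab h
  have hyb : P y < P b := by by_contra! hn; exact hdom ⟨le_rfl, hn⟩
  by_cases hb : I b b
  · obtain ⟨rfl, -⟩ := hD.eq_of_right_diag h2 hI hb hne hab h hdom
    exact lt_irrefl _ hyb
  by_cases hy : I y y
  · have key := hD.leibniz y y x b hy hab x y
    have l2 := hD.le_of_ne_zero hI (x := b) (y := y) hy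
    grind
  -- Factor E_xb = [E_xs, E_sb]: the only term left at (x, y) is the (s, y) entry of f(E_sb), which
  -- lies below the block diagonal since `P y < P s`.
  obtain ⟨s, hs, hys, hsb⟩ := hI.exists_diag y b (hI.of_lt _ _ hyb)
  have hys' : P y < P s := lt_of_le_of_ne hys fun e => hy (hI.diag_of_eq hs e)
  have hxs : I x s := hI.of_diag _ _ s hs (hxy.trans hys) le_rfl
  have hsb' : I s b := hI.of_diag _ _ s hs le_rfl hsb
  have key := hD.leibniz x s s b hxs hsb' x y
  have l := hD.le_of_ne_zero hI (x := s) (y := y) hsb'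
  grind

theorem IsDerivationTable.right_diag (h2 : (2 : F) ≠ 0) (hD : IsDerivationTable I D)
    (hI : IsBlockPattern I P) (hgap : ∃ g, ¬ I g g) {a b x y : ι} (hb : I b b)
    (hab : I a b) (h : D a b x y ≠ 0) : P x ≤ P a ∧ P b ≤ P y := by
  by_cases ha : I a a
  · exact hD.left_diag h2 hI hgap ha hab h
  have hne : a ≠ b := by rintro rfl; exact ha hb
  by_contra hdom
  obtain ⟨rfl, hxb⟩ := hD.eq_of_right_diag h2 hI hb hne hab h hdom
  have hxy := hD.le_of_ne_zero hI hab h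
  have hax : P a < P x := by by_contra! hn; exact hdom ⟨hn, le_rfl⟩
  by_cases hx : I x x
  · have key := hD.leibniz x x a y hx hab x y
    have l2 := hD.le_of_ne_zero hI (x := x) (y := a) hx
    grind
  obtain ⟨s, hs, has, hsx⟩ := hI.exists_diag a x (hI.of_lt _ _ hax)
  have hsx' : P s < P x := lt_of_le_of_ne hsx fun e => hx (hI.diag_of_eq hs e.symm)
  have hsy : I s y := hI.of_diag _ _ s hs le_rfl (hsx.trans hxy)
  have has' : I a s := hI.of_diag _ _ s hs has le_rfl
  have key := hD.leibniz a s s y has' hsy x y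
  have l := hD.le_of_ne_zero hI (x := x) (y := s) has'
  grind

theorem IsDerivationTable.dominates (h2 : (2 : F) ≠ 0) (hD : IsDerivationTable I D)
    (hI : IsBlockPattern I P) (hgap : ∃ g, ¬ I g g) {a b x y : ι}
    (hab : I a b) (h : D a b x y ≠ 0) : P x ≤ P a ∧ P b ≤ P y := by
  by_cases ha : I a a
  · exact hD.left_diag h2 hI hgap ha hab h
  by_cases hb : I b b
  · exact hD.right_diag h2 hI hgap hb hab h
  obtain ⟨s, hs, has, hsb⟩ := hI.exists_diag a b hab
  have has' : P a < P s := lt_of_le_of_ne has fun e => ha (hI.diag_of_eq hs e)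
  have hIas : I a s := hI.of_diag _ _ s hs has le_rfl
  have hIsb : I s b := hI.of_diag _ _ s hs le_rfl hsb
  have key := hD.leibniz a s s b hIas hIsb x y
  have l1 := hD.right_diag h2 hI hgap (x := x) (y := s) hs hIas
  have l2 := hD.right_diag h2 hI hgap (x := b) (y := y) hs hIas
  have l3 := hD.left_diag h2 hI hgap (x := s) (y := y) hs hIsb
  have l4 := hD.left_diag h2 hI hgap (x := x) (y := a) hs hIsb
  grind

end Table

/-! ### From DUT ladders to block patterns -/

namespace Ladder

variable {n : ℕ} {L : Ladder n}

theorem part_mono (L : Ladder n) : Monotone L.part := by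
  intro a b hab
  refine Fin.mk_le_mk.2 (Finset.card_le_card ?_)
  exact Finset.monotone_filter_right _ fun c _ hc => le_trans hc hab

theorem part_lt_iff {a b : Fin n} :
    L.part a < L.part b ↔ ∃ c ∈ L.partition, (a : ℕ) < c ∧ c ≤ b := by
  constructor
  · intro h
    by_contra! hn
    refine absurd h (not_lt.2 (Fin.mk_le_mk.2 (Finset.card_le_card fun c hc => ?_)))
    simp only [Finset.mem_filter] at hc ⊢
    exact ⟨hc.1, by by_contra! hlt; exact absurd hc.2 (not_le.2 (hn c hc.1 hlt))⟩
  · rintro ⟨c, hc, hac, hcb⟩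
    refine Fin.mk_lt_mk.2 (Finset.card_lt_card ⟨?_, fun hsub => ?_⟩)
    · exact Finset.monotone_filter_right _ fun d _ hd => by
        have : (a : ℕ) < b := hac.trans_le hcb
        exact le_trans hd this.le
    · have := hsub (Finset.mem_filter.2 ⟨hc, hcb⟩)
      exact absurd (Finset.mem_filter.1 this).2 (not_le.2 hac)

theorem mem_partition {c : ℕ} : c ∈ L.partition ↔
    ((∃ l, (L.row l : ℕ) + 1 = c) ∨ ∃ l, (L.col l : ℕ) = c) ∧ c ≠ 0 ∧ c ≠ n := by
  simp [partition]

/-- The part number grows by at most one from each index to the next, so the least index reaching k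
hits it exactly. -/
theorem exists_part_eq (hn : 0 < n) (k : Fin L.numParts) : ∃ a, L.part a = k := by
  classical
  have hlast : k ≤ L.part ⟨n - 1, by omega⟩ := by
    rw [Fin.le_def]
    have : L.partition.filter (fun c => c ≤ n - 1) = L.partition := by
      refine Finset.filter_true_of_mem fun c hc => ?_
      obtain ⟨h | h, h0, hne⟩ := mem_partition.1 hc <;> obtain ⟨l, rfl⟩ := h <;>
        omega
    simp only [part, this]
    exact Nat.le_of_lt_succ k.2
  have hex : ∃ m, ∃ h : m < n, k ≤ L.part ⟨m, h⟩ := ⟨_, _, hlast⟩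
  obtain ⟨hm, hk⟩ := Nat.find_spec hex
  refine ⟨⟨Nat.find hex, hm⟩, le_antisymm ?_ hk⟩
  rcases Nat.eq_zero_or_pos (Nat.find hex) with h0 | hpos
  · rw [Fin.le_def]
    have : L.partition.filter (fun c => c ≤ Nat.find hex) = ∅ := by
      refine Finset.filter_false_of_mem fun c hc => ?_
      have := (mem_partition.1 hc).2.1
      omega
    exact (Finset.card_eq_zero.2 this).trans_le (Nat.zero_le _)
  · have hprev := Nat.find_min hex (Nat.sub_lt hpos one_pos)
    have hlt : L.part ⟨Nat.find hex - 1, by omega⟩ < k := by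
      by_contra! h
      exact hprev ⟨_, h⟩
    rw [Fin.lt_def] at hlt
    rw [Fin.le_def]
    refine le_trans ?_ (Nat.succ_le_of_lt hlt)
    have hsub : L.partition.filter (fun c => c ≤ Nat.find hex) ⊆
        insert (Nat.find hex) (L.partition.filter (fun c => c ≤ Nat.find hex - 1)) := by
      intro c hc
      simp only [Finset.mem_filter, Finset.mem_insert] at hc ⊢
      by_cases h : c = Nat.find hex
      · exact Or.inl h
      · exact Or.inr ⟨hc.1, by omega⟩
    exact (Finset.card_le_card hsub).trans (Finset.card_insert_le _ _)

theorem IsDUT.row_lt_col (hL : L.IsDUT) {l m : Fin L.step} (h : l < m) : L.row l < L.col m := by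
  have hlt : (l : ℕ) + 1 < L.step := lt_of_le_of_lt (Nat.succ_le_of_lt h) m.2
  exact (hL.isUpperTriangular l ⟨_, hlt⟩ rfl).trans_le
    (L.col_strictMono.monotone (Fin.le_def.2 (Nat.succ_le_of_lt h)))

/-- The intervals from `col` to `row` are disjoint and ordered, so no cut falls inside one. -/
theorem IsDUT.part_row_eq (hL : L.IsDUT) (l : Fin L.step) :
    L.part (L.row l) = L.part (L.col l) := by
  refine le_antisymm ?_ (L.part_mono (hL.col_le_row l))
  by_contra! h
  obtain ⟨c, hc, h1, h2⟩ := part_lt_iff.1 h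
  obtain ⟨⟨m, rfl⟩ | ⟨m, rfl⟩, -, -⟩ := mem_partition.1 hc
  · rcases lt_or_ge m l with hml | hml
    · have := Fin.lt_def.1 (hL.row_lt_col hml); omega
    · have := Fin.le_def.1 (L.row_strictMono.monotone hml); omega
  · rcases lt_or_ge l m with hml | hml
    · have := Fin.lt_def.1 (hL.row_lt_col hml); omega
    · have := Fin.le_def.1 (L.col_strictMono.monotone hml); omega

theorem le_row_of_part_le {a : Fin n} {l : Fin L.step} (h : L.part a ≤ L.part (L.row l)) :
    a ≤ L.row l := by
  by_contra! hlt
  rw [Fin.lt_def] at hlt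
  refine absurd h (not_le.2 (part_lt_iff.2 ⟨L.row l + 1, mem_partition.2 ⟨Or.inl ⟨l, rfl⟩, ?_⟩,
    Nat.lt_succ_self _, hlt⟩))
  have := a.2
  omega

theorem col_le_of_part_le {b : Fin n} {l : Fin L.step} (h : L.part (L.col l) ≤ L.part b) :
    L.col l ≤ b := by
  by_contra! hlt
  rw [Fin.lt_def] at hlt
  refine absurd h (not_le.2 (part_lt_iff.2 ⟨L.col l, mem_partition.2 ⟨Or.inr ⟨l, rfl⟩, ?_⟩,
    hlt, le_rfl⟩))
  have := (L.col l).2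
  omega

theorem IsDUT.row_row_mem (hL : L.IsDUT) (l : Fin L.step) : (L.row l, L.row l) ∈ L.indexSet :=
  ⟨l, le_rfl, hL.col_le_row l⟩

theorem IsDUT.isBlockPattern (hL : L.IsDUT) :
    IsBlockPattern (fun a b => (a, b) ∈ L.indexSet) (fun a => (L.part a : ℕ)) where
  exists_diag := by
    rintro a b ⟨l, h1, h2⟩
    refine ⟨L.row l, hL.row_row_mem l, L.part_mono h1, ?_⟩
    have := L.part_mono h2
    rw [← hL.part_row_eq] at this
    exact this
  of_diag := by
    rintro a b s ⟨l, h1, h2⟩ has hsb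
    refine ⟨l, le_row_of_part_le (le_trans has (L.part_mono h1)), ?_⟩
    exact col_le_of_part_le (le_trans (L.part_mono h2) hsb)
  of_lt := by
    intro a b h
    -- The corner that produces a cut between a and b dominates (a, b).
    obtain ⟨c, hc, h1, h2⟩ := part_lt_iff.1 (Fin.lt_def.2 h)
    obtain ⟨⟨l, rfl⟩ | ⟨l, rfl⟩, -, -⟩ := mem_partition.1 hc
    · refine ⟨l, Fin.le_def.2 (Nat.le_of_lt_succ h1), (hL.col_le_row l).trans ?_⟩
      exact Fin.le_def.2 (Nat.le_of_succ_le h2)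
    · exact ⟨l, (Fin.lt_def.2 h1).le.trans (hL.col_le_row l), Fin.le_def.2 h2⟩

/-! ### The table of a derivation of M_L -/

theorem single_mem_matrices {F : Type*} [Field F] {a b : Fin n} (h : (a, b) ∈ L.indexSet) (r : F) :
    Matrix.single a b r ∈ L.matrices F := by
  intro x y hxy
  refine Matrix.single_apply_of_ne _ _ _ _ _ ?_
  rintro ⟨rfl, rfl⟩
  exact hxy h

/-- The matrix unit at a position of `I(L)`, as an element of the Lie algebra `M_L`. -/
def matrixUnit (F : Type*) [Field F] (hL : L.IsUpperTriangular) {a b : Fin n}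
    (h : (a, b) ∈ L.indexSet) : L.lieAlgebra hL F :=
  ⟨Matrix.single a b 1, single_mem_matrices h 1⟩

open Classical in
/-- The entries of the images of the matrix units of `M_L` under `f`. -/
noncomputable def table {F : Type*} [Field F] {hL : L.IsUpperTriangular}
    (f : L.lieAlgebra hL F → L.lieAlgebra hL F) (a b x y : Fin n) : F :=
  if h : (a, b) ∈ L.indexSet then (f (matrixUnit F hL h) : Matrix (Fin n) (Fin n) F) x y else 0

theorem mem_indexSet_trans (hL : L.IsUpperTriangular) {a b c : Fin n} (hab : (a, b) ∈ L.indexSet)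
    (hbc : (b, c) ∈ L.indexSet) : (a, c) ∈ L.indexSet := by
  by_contra hac
  -- The statement is combinatorial; any field would serve in place of ℚ.
  have := L.mul_mem_matrices hL ℚ (single_mem_matrices hab 1) (single_mem_matrices hbc 1) a c hac
  simp at this

theorem isDerivationTable {F : Type*} [Field F] {hL : L.IsUpperTriangular}
    (f : LieDerivation F (L.lieAlgebra hL F) (L.lieAlgebra hL F)) :
    IsDerivationTable (fun a b => (a, b) ∈ L.indexSet) (table f) where
  support := by
    intro a b hab x y hxy
    rw [table, dif_pos hab]
    exact (f (matrixUnit F hL hab)).2 x y hxy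
  leibniz := by
    intro a b c d hab hcd x y
    have hbr : ⁅matrixUnit F hL hab, matrixUnit F hL hcd⁆ =
        (if h : b = c then matrixUnit F hL (mem_indexSet_trans hL hab (h ▸ hcd)) else 0) -
        (if h : d = a then matrixUnit F hL (mem_indexSet_trans hL hcd (h ▸ hab)) else 0) := by
      apply Subtype.ext
      rw [LieSubalgebra.coe_bracket, Ring.lie_def]
      by_cases h1 : b = c <;> by_cases h2 : d = a
      · subst h1 h2; simp [matrixUnit]
      · subst h1; simp [matrixUnit, h2]
      · subst h2; simp [matrixUnit, h1]
      · simp [matrixUnit, h1, h2]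
    have hf := f.apply_lie_eq_add (matrixUnit F hL hab) (matrixUnit F hL hcd)
    rw [hbr, map_sub] at hf
    have hxy := congrFun (congrFun (congrArg Subtype.val hf) x) y
    have e1 : (if b = c then table f a d x y else 0) =
        (f (if h : b = c then matrixUnit F hL (mem_indexSet_trans hL hab (h ▸ hcd)) else 0) :
          Matrix (Fin n) (Fin n) F) x y := by
      by_cases h : b = c
      · subst h
        simp [table, mem_indexSet_trans hL hab hcd]
      · simp [h]
    have e2 : (if d = a then table f c b x y else 0) =
        (f (if h : d = a then matrixUnit F hL (mem_indexSet_trans hL hcd (h ▸ hab)) else 0) :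
          Matrix (Fin n) (Fin n) F) x y := by
      by_cases h : d = a
      · subst h
        simp [table, mem_indexSet_trans hL hcd hab]
      · simp [h]
    rw [e1, e2]
    refine Eq.trans hxy ?_
    simp only [table, dif_pos hab, dif_pos hcd]
    rw [add_comm]
    have mul_unit : ∀ (M : Matrix (Fin n) (Fin n) F) (p q : Fin n),
        (M * Matrix.single p q (1 : F)) x y = if q = y then M x p else 0 := by
      intro M p q
      by_cases h : q = y
      · subst h; simp
      · simp [h, Ne.symm h]
    have unit_mul : ∀ (M : Matrix (Fin n) (Fin n) F) (p q : Fin n),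
        (Matrix.single p q (1 : F) * M) x y = if x = p then M q y else 0 := by
      intro M p q
      by_cases h : x = p
      · subst h; simp
      · simp [h]
    have hb : ∀ M N : L.lieAlgebra hL F, (⁅M, N⁆ : L.lieAlgebra hL F).1 x y =
        (M.1 * N.1) x y - (N.1 * M.1) x y := fun M N => rfl
    refine (congrArg₂ (· + ·) (hb _ _) (hb _ _)).trans ?_
    simp only [matrixUnit, mul_unit, unit_mul, eq_comm]

theorem apply_eq_sum_table {F : Type*} [Field F] {hL : L.IsUpperTriangular}
    (f : L.lieAlgebra hL F →ₗ[F] L.lieAlgebra hL F) (A : L.lieAlgebra hL F) (x y : Fin n) :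
    (f A : Matrix (Fin n) (Fin n) F) x y =
      ∑ a, ∑ b, (A : Matrix (Fin n) (Fin n) F) a b * table f a b x y := by
  classical
  have hA : A = ∑ a, ∑ b, if h : (a, b) ∈ L.indexSet then
      (A : Matrix (Fin n) (Fin n) F) a b • matrixUnit F hL h else 0 := by
    apply Subtype.ext
    rw [AddSubmonoidClass.coe_finsetSum]
    conv_lhs => rw [Matrix.matrix_eq_sum_single (A : Matrix (Fin n) (Fin n) F)]
    refine Finset.sum_congr rfl fun a _ => ?_
    rw [AddSubmonoidClass.coe_finsetSum]
    refine Finset.sum_congr rfl fun b _ => ?_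
    by_cases h : (a, b) ∈ L.indexSet
    · simp [h, matrixUnit]
    · simp [h, A.2 a b h]
  conv_lhs => rw [hA]
  simp only [map_sum, AddSubmonoidClass.coe_finsetSum, Matrix.sum_apply]
  refine Finset.sum_congr rfl fun a _ => Finset.sum_congr rfl fun b _ => ?_
  by_cases h : (a, b) ∈ L.indexSet
  · simp [h, table]
  · simp [h, table]

theorem mem_iSup_block {F : Type*} [Field F] {T : Set (Fin L.numParts × Fin L.numParts)}
    {M : Matrix (Fin n) (Fin n) F} (h : ∀ x y, M x y ≠ 0 → (L.part x, L.part y) ∈ T) :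
    M ∈ ⨆ z ∈ T, L.block F z.1 z.2 := by
  rw [Matrix.matrix_eq_sum_single M]
  refine Submodule.sum_mem _ fun x _ => Submodule.sum_mem _ fun y _ => ?_
  by_cases h0 : M x y = 0
  · rw [h0, Matrix.single_zero]
    exact Submodule.zero_mem _
  · refine Submodule.mem_iSup_of_mem (L.part x, L.part y)
      (Submodule.mem_iSup_of_mem (h x y h0) ?_)
    intro a b hab
    refine Matrix.single_apply_of_ne _ _ _ _ _ ?_
    rintro ⟨rfl, rfl⟩
    exact hab ⟨rfl, rfl⟩

end Ladder

theorem mainTheorem6 {F : Type*} [Field F] (hF : ringChar F ≠ 2) {n : ℕ} (L : Ladder n)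
    (hL : L.IsDUT)
    (hzero : ∃ k : Fin L.numParts, (k, k) ∉ L.blockIndexSet F)
    (f : LieDerivation F (L.lieAlgebra hL.isUpperTriangular F)
      (L.lieAlgebra hL.isUpperTriangular F))
    (i j : Fin L.numParts) (hij : (i, j) ∈ L.blockIndexSet F)
    (A : L.lieAlgebra hL.isUpperTriangular F)
    (hA : (A : Matrix (Fin n) (Fin n) F) ∈ L.block F i j) :
    (f A : Matrix (Fin n) (Fin n) F) ∈
      ⨆ x ∈ {x | x ∈ L.blockIndexSet F ∧ Dominates (i, j) x}, L.block F x.1 x.2 := by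
  have hgap : ∃ g, (g, g) ∉ L.indexSet := by
    obtain ⟨-, -, a, -⟩ := hij
    obtain ⟨k, hk⟩ := hzero
    obtain ⟨g, rfl⟩ := Ladder.exists_part_eq a.pos k
    exact ⟨g, fun hg => hk ⟨_, Ladder.single_mem_matrices hg 1, g, g, rfl, rfl, by simp⟩⟩
  refine Ladder.mem_iSup_block fun x y hxy => ⟨⟨_, (f A).2, x, y, rfl, rfl, hxy⟩, ?_⟩
  have hsum := Ladder.apply_eq_sum_table (f : _ →ₗ[F] _) A x y
  rw [LieDerivation.coeFn_coe] at hsum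
  rw [hsum] at hxy
  obtain ⟨a, -, ha⟩ := Finset.exists_ne_zero_of_sum_ne_zero hxy
  obtain ⟨b, -, hb⟩ := Finset.exists_ne_zero_of_sum_ne_zero ha
  have hAab := left_ne_zero_of_mul hb
  have hab : (a, b) ∈ L.indexSet := by
    by_contra h
    exact hAab (A.2 a b h)
  have hpart : L.part a = i ∧ L.part b = j := by
    by_contra h
    exact hAab (hA a b h)
  obtain ⟨rfl, rfl⟩ := hpart
  exact (Ladder.isDerivationTable f).dominates (Ring.two_ne_zero hF) hL.isBlockPattern hgap hab
    (right_ne_zero_of_mul hb)
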